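/- Let $V\subset\mathbb{C}^n$ be an irreducible algebraic variety of dimension $m>0$ and degree $d$, where $d$ is the number of points in which $V$ meets a general affine-linear subspace of codimension $m$. Let $(x,y)$ be coordinates on $\mathbb{C}^n$ with $x\in\mathbb{C}^{n-m}$ and $y\in\mathbb{C}^m$, and let $\Delta\subset\mathbb{C}^m$ be the set of points $y$ over which the fiber of the projection $\pi\colon V\to\mathbb{C}^m$, $(x,y)\mapsto y$, does not consist of exactly $d$ points (the ramification locus). Suppose that $V$ is in general position with respect to these coordinates, in the sense that $\Delta$ is contained in a proper Zariski-closed subset of $\mathbb{C}^m$. Let $\ell\subset\mathbb{C}^m$ be a line with an affine parameter $t\in\mathbb{C}$, and let $C:=V\cap(\mathbb{C}^{n-m}\times\ell)$, with coordinates $(x,t)$. Then the sum in $\mathbb{C}^{n-m}$ of the $d$ points in the fiber of $C$ over $t\in\ell\smallsetminus\Delta$ is an affine function of $t$: there are $c_0,c_1\in\mathbb{C}^{n-m}$ such that for every $t\in\ell\smallsetminus\Delta$ the fiber $\{x\in\mathbb{C}^{n-m} : (x,t)\in C\}$ has exactly $d$ points and their sum equals $c_0t+c_1$. -/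

import Mathlib

open MvPolynomial

/-- A property of points of the affine space `ℂ^σ` holds for a *general* point if it holds on a
nonempty (basic) Zariski-open subset, i.e. wherever some fixed nonzero polynomial does not
vanish. -/
def ForGeneral {σ : Type*} (p : (σ → ℂ) → Prop) : Prop :=
  ∃ P : MvPolynomial σ ℂ, P ≠ 0 ∧ ∀ a : σ → ℂ, eval a P ≠ 0 → p a

/-- The section of `V ⊆ ℂ^τ` by the affine-linear subspace `{v | M v = b}` given by `m` affine
equations. The datum `a` lists the entries of the `m × τ` matrix `M` and of the vector `b ∈ ℂ^m`.
For general `a` the subspace has codimension `m`. -/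
def linearSection {τ : Type*} [Fintype τ] {m : ℕ} (V : Set (τ → ℂ))
    (a : (Fin m × τ) ⊕ Fin m → ℂ) : Set (τ → ℂ) :=
  {v ∈ V | ∀ i, ∑ j, a (Sum.inl (i, j)) * v j = a (Sum.inr i)}

/-- The degree of a subvariety `V ⊆ ℂ^τ` of pure dimension `m`: the number of points in which `V`
meets a general affine-linear subspace of codimension `m`. (Two numbers with this property are
equal, since two nonempty Zariski-open sets meet.) -/
noncomputable def varietyDegree {τ : Type*} [Fintype τ] (m : ℕ) (V : Set (τ → ℂ)) : ℕ :=
  sInf {d : ℕ | ForGeneral fun a : (Fin m × τ) ⊕ Fin m → ℂ => (linearSection V a).encard = d}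

/-- The fiber over `y ∈ ℂ^m` of the projection `(x, y) ↦ y` restricted to `V ⊆ ℂ^k × ℂ^m`,
as a set of points `x ∈ ℂ^k`. -/
def fiber {k m : ℕ} (V : Set (Fin k ⊕ Fin m → ℂ)) (y : Fin m → ℂ) : Set (Fin k → ℂ) :=
  {x | Sum.elim x y ∈ V}

/-- The ramification locus `Δ ⊆ ℂ^m` of the projection of an `m`-dimensional `V ⊆ ℂ^k × ℂ^m` to
`ℂ^m`: the points whose fiber does not consist of exactly `deg V` points. -/
def ramificationLocus {k m : ℕ} (V : Set (Fin k ⊕ Fin m → ℂ)) : Set (Fin m → ℂ) :=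
  {y | (fiber V y).encard ≠ varietyDegree m V}

/-- `V` is in general position with respect to the coordinates `(x, y)`: its projection to `ℂ^m`
is a branched cover with `deg V` points in the fibers over the complement of the ramification
locus, which is contained in a proper Zariski-closed subset of `ℂ^m`. -/
def InGeneralPosition {k m : ℕ} (V : Set (Fin k ⊕ Fin m → ℂ)) : Prop :=
  ForGeneral fun y : Fin m → ℂ => y ∉ ramificationLocus V

/-- The point with parameter `t` on the line `ℓ = {p + t q | t ∈ ℂ}` in `ℂ^m`. -/
def linePoint {m : ℕ} (p q : Fin m → ℂ) (t : ℂ) : Fin m → ℂ := p + t • q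

/-- The curve `C = V ∩ (ℂ^k × ℓ)` in the coordinates `(x, t)` of `ℂ^k × ℓ`, where `ℓ` is the line
`{p + t q | t ∈ ℂ}`. -/
def sectionCurve {k m : ℕ} (V : Set (Fin k ⊕ Fin m → ℂ)) (p q : Fin m → ℂ) :
    Set ((Fin k → ℂ) × ℂ) :=
  {c | Sum.elim c.1 (linePoint p q c.2) ∈ V}

/-! For a linear form `u` in `x`, the `m + 1` linear forms `u ⬝ᵥ x, y₁, …, y_m` satisfy on `V` a
nonzero relation `G(T, y)` of total degree at most `d` (`exists_relation_of_forGeneral`). If its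
coefficient of `T ^ d` is nonzero, that coefficient is a constant and the coefficient of `T ^ (d -
1)` has degree at most 1 in `y`. Where `u` separates the `d` points of a fiber, Vieta then makes the
sum of `u ⬝ᵥ x` affine in `t` (`exists_affine_sum`).

To get `G`, a shear brings general forms into a position where `θ` is integral over the other `m`.
The minimal polynomial of `θ` has degree at most `d`, by counting points over a general value
(`natDegree_minpoly_le_of_encard_le`), and its total degree is no larger. For arbitrary forms,
having a relation of degree at most `d` is a closed condition (`exists_relation_of_general`).

A given `u` may fail to separate points or to give degree `d` in `T`. So `u` runs over the moment
curve: each obstruction excludes finitely many parameters, and a vector killed by infinitely many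
`momentVector k s` is zero. -/

/-! ### Specialization of polynomials and extension of homomorphisms to a field -/

/-- The resultant depends on the degrees; `f` being monic and characteristic zero keep both degrees
fixed under `χ`. -/
theorem Polynomial.resultant_derivative_map {A K : Type*} [CommRing A] [IsDomain A] [CharZero A]
    [Field K] [CharZero K] (χ : A →+* K) {f : Polynomial A} (hf : f.Monic) :
    (f.map χ).resultant (f.map χ).derivative = χ (f.resultant f.derivative) := by
  rw [← Polynomial.resultant_map_map, hf.natDegree_map, Polynomial.natDegree_derivative,
    Polynomial.natDegree_derivative, hf.natDegree_map, Polynomial.derivative_map]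

/-- A separable monic polynomial over a domain stays separable under all specializations at which
some fixed nonzero element does not vanish. -/
theorem Polynomial.exists_separable_specialization {A K : Type*} [CommRing A] [IsDomain A]
    [CharZero A] [Field K] [CharZero K] {f : Polynomial A} (hf : f.Monic)
    (hsep : (f.map (algebraMap A (FractionRing A))).Separable) :
    ∃ g : A, g ≠ 0 ∧ ∀ χ : A →+* K, χ g ≠ 0 → (f.map χ).Separable := by
  refine ⟨f.resultant f.derivative, fun h => ?_, fun χ h => ?_⟩
  · have : CharZero (FractionRing A) :=
      charZero_of_injective_algebraMap (IsFractionRing.injective A (FractionRing A))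
    have := Polynomial.resultant_ne_zero _ _ hsep
    rw [Polynomial.resultant_derivative_map _ hf, h, map_zero] at this
    exact this rfl
  · rw [← Polynomial.resultant_derivative_map χ hf] at h
    exact (Polynomial.isUnit_resultant_iff_isCoprime (hf.map χ)).1 h.isUnit

/-- A homomorphism to an algebraically closed field extends along an integral extension. -/
theorem exists_ringHom_extension_of_isIntegral {A B K : Type*} [CommRing A] [CommRing B]
    [Algebra A B] [Algebra.IsIntegral A B] [Field K] [IsAlgClosed K] (χ : A →+* K)
    (hχ : RingHom.ker (algebraMap A B) ≤ RingHom.ker χ) :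
    ∃ ψ : B →+* K, ψ.comp (algebraMap A B) = χ := by
  have := RingHom.ker_isPrime χ
  obtain ⟨Q, -, hQ, hQP⟩ := Ideal.exists_ideal_over_prime_of_isIntegral (RingHom.ker χ) (⊥ : Ideal B)
    (by rwa [← RingHom.ker_eq_comap_bot])
  have : Q.LiesOver (RingHom.ker χ) := ⟨hQP.symm⟩
  let χ' : A ⧸ RingHom.ker χ →+* K := RingHom.kerLift χ
  let := χ'.toAlgebra
  have : FaithfulSMul (A ⧸ RingHom.ker χ) K :=
    (faithfulSMul_iff_algebraMap_injective _ _).2 (RingHom.kerLift_injective χ)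
  have : Algebra.IsIntegral (A ⧸ RingHom.ker χ) (B ⧸ Q) :=
    Ideal.Quotient.algebra_isIntegral_of_liesOver _ _
  have : Module.IsTorsionFree (A ⧸ RingHom.ker χ) (B ⧸ Q) :=
    Module.isTorsionFree_iff_faithfulSMul.2 inferInstance
  let F : B ⧸ Q →ₐ[A ⧸ RingHom.ker χ] K := IsAlgClosed.lift
  refine ⟨(F : B ⧸ Q →+* K).comp (Ideal.Quotient.mk Q), RingHom.ext fun a => ?_⟩
  exact F.commutes (Ideal.Quotient.mk _ a)

theorem exists_pow_mul_mem_of_adjoin_eq_top {A B : Type*} [CommRing A] [CommRing B] [Algebra A B]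
    (S : Subalgebra A B) (g : A) (s : Set B) (hs : Algebra.adjoin A s = ⊤)
    (h : ∀ x ∈ s, algebraMap A B g * x ∈ S) (b : B) :
    ∃ n : ℕ, algebraMap A B g ^ n * b ∈ S := by
  have hg : ∀ n : ℕ, algebraMap A B g ^ n ∈ S := fun n => S.pow_mem (S.algebraMap_mem g) n
  have hb : b ∈ Algebra.adjoin A s := hs ▸ Algebra.mem_top
  induction hb using Algebra.adjoin_induction with
  | mem x hx => exact ⟨1, by simpa using h x hx⟩
  | algebraMap r => exact ⟨0, by simp⟩
  | add x y _ _ hx hy =>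
    obtain ⟨n, hn⟩ := hx
    obtain ⟨k, hk⟩ := hy
    refine ⟨n + k, ?_⟩
    rw [show algebraMap A B g ^ (n + k) * (x + y) = algebraMap A B g ^ k * (algebraMap A B g ^ n * x)
      + algebraMap A B g ^ n * (algebraMap A B g ^ k * y) by ring]
    exact S.add_mem (S.mul_mem (hg _) hn) (S.mul_mem (hg _) hk)
  | mul x y _ _ hx hy =>
    obtain ⟨n, hn⟩ := hx
    obtain ⟨k, hk⟩ := hy
    refine ⟨n + k, ?_⟩
    rw [show algebraMap A B g ^ (n + k) * (x * y) = (algebraMap A B g ^ n * x)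
      * (algebraMap A B g ^ k * y) by ring]
    exact S.mul_mem hn hk

/-- A homomorphism to a field from a subalgebra `S` extends to `B` if it does not kill an element
`g` of the base ring, powers of which multiply `B` into `S`. -/
theorem exists_ringHom_extension_of_pow_mul_mem {A B K : Type*} [CommRing A] [CommRing B]
    [IsDomain B] [Algebra A B] [FaithfulSMul A B] [Field K] (S : Subalgebra A B) (φ : S →+* K) (g : A)
    (hg : φ (algebraMap A S g) ≠ 0) (h : ∀ b : B, ∃ n : ℕ, algebraMap A B g ^ n * b ∈ S) :
    ∃ ψ : B →+* K, ∀ x : S, ψ x = φ x := by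
  have hgB : algebraMap A B g ≠ 0 := fun h0 => hg <| by
    rw [show algebraMap A S g = 0 from Subtype.ext h0, map_zero]
  let L := Localization.Away (algebraMap A B g)
  let : Algebra S L := ((algebraMap B L).comp (algebraMap S B)).toAlgebra
  have hSL : ∀ x : S, algebraMap S L x = algebraMap B L x := fun _ => rfl
  have hinj : Function.Injective (algebraMap B L) := IsLocalization.injective L
    (powers_le_nonZeroDivisors_of_noZeroDivisors hgB)
  -- Inverting `g` erases the difference between `S` and `B`, so `φ` extends by the universal
  -- property.
  have hloc : IsLocalization.Away (algebraMap A S g) L := by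
    refine ⟨?_, ?_, ?_⟩
    · rintro ⟨_, n, rfl⟩
      have := IsLocalization.Away.algebraMap_isUnit (S := L) (algebraMap A B g)
      simpa [hSL] using this.pow n
    · intro z
      obtain ⟨n, b, hb⟩ := IsLocalization.Away.surj (algebraMap A B g) z
      obtain ⟨k, hk⟩ := h b
      refine ⟨⟨⟨_, hk⟩, ⟨algebraMap A S g ^ (n + k), n + k, rfl⟩⟩, ?_⟩
      simp only [hSL, map_mul, map_pow, ← hb, SubmonoidClass.coe_pow, Subalgebra.coe_algebraMap]
      ring
    · intro x y hxy
      refine ⟨1, ?_⟩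
      rw [Subtype.ext (hinj hxy)]
  refine ⟨(IsLocalization.Away.lift (S := L) (algebraMap A S g) hg.isUnit).comp (algebraMap B L),
    fun x => ?_⟩
  exact IsLocalization.Away.lift_eq (S := L) (algebraMap A S g) hg.isUnit x

/-- A general homomorphism from `A` to an algebraically closed field extends to `B`, with any root
of the specialized minimal polynomial of `θ` as the value at `θ`. -/
theorem exists_ringHom_extension_of_root_minpoly {A B K : Type*} [CommRing A] [CommRing B]
    [IsDomain A] [IsDomain B] [IsIntegrallyClosed A] [Algebra A B] [FaithfulSMul A B]
    [Algebra.IsAlgebraic A B] [Algebra.FiniteType A B] [Field K] [IsAlgClosed K]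
    {θ : B} (hθ : IsIntegral A θ) :
    ∃ g : A, g ≠ 0 ∧ ∀ χ : A →+* K, χ g ≠ 0 → ∀ t : K, ((minpoly A θ).map χ).eval t = 0 →
      ∃ ψ : B →+* K, ψ.comp (algebraMap A B) = χ ∧ ψ θ = t := by
  obtain ⟨s, hs⟩ := Algebra.FiniteType.out (R := A) (A := B)
  obtain ⟨g, hg0, hg⟩ := Algebra.IsAlgebraic.exists_integral_multiples A s
  refine ⟨g, hg0, fun χ hχ t ht => ?_⟩
  let S := integralClosure A B
  let θ' : S := ⟨θ, hθ⟩
  let χ' : Polynomial A →+* K := Polynomial.eval₂RingHom χ t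
  -- Working over `A[X]`, with `X` acting as `θ`, prescribes the values on `A` and at `θ` in a
  -- single homomorphism `χ'`.
  let : Algebra (Polynomial A) S := (Polynomial.aeval θ').toAlgebra
  have : IsScalarTower A (Polynomial A) S := IsScalarTower.of_algebraMap_eq fun a => by
    change _ = Polynomial.aeval θ' (Polynomial.C a)
    simp
  have : Algebra.IsIntegral (Polynomial A) S := Algebra.IsIntegral.tower_top A
  obtain ⟨φ, hφ⟩ := exists_ringHom_extension_of_isIntegral (B := S) χ' (by
    intro p hp
    have hp' : Polynomial.aeval θ p = 0 := by
      have h1 : Polynomial.aeval θ' p = 0 := hp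
      exact (Polynomial.aeval_algHom_apply S.val θ' p).trans (by rw [h1, map_zero])
    obtain ⟨q, rfl⟩ := minpoly.isIntegrallyClosed_dvd hθ hp'
    rw [Polynomial.eval_map] at ht
    simp [χ', RingHom.mem_ker, ht])
  have hφA : ∀ a, φ (algebraMap A S a) = χ a := fun a => by
    have := RingHom.congr_fun hφ (Polynomial.C a)
    simpa [χ', RingHom.algebraMap_toAlgebra] using this
  have hφθ : φ θ' = t := by
    have := RingHom.congr_fun hφ Polynomial.X
    simpa [χ', RingHom.algebraMap_toAlgebra] using this
  obtain ⟨ψ, hψ⟩ := exists_ringHom_extension_of_pow_mul_mem S φ g (by rwa [hφA])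
    (exists_pow_mul_mem_of_adjoin_eq_top S g s hs fun x hx => by
      simpa [Algebra.smul_def, S, mem_integralClosure_iff] using hg x hx)
  exact ⟨ψ, RingHom.ext fun a => (hψ (algebraMap A S a)).trans (hφA a), (hψ θ').trans hφθ⟩

/-! ### Transcendence degree and degrees of minimal polynomials -/

theorem ringKrullDim_le_of_isIntegral_of_injective {A B : Type*} [CommRing A] [CommRing B]
    [Algebra A B] [Algebra.IsIntegral A B] [FaithfulSMul A B] :
    ringKrullDim A ≤ ringKrullDim B := by
  refine iSup_le fun l => ?_
  obtain ⟨⟨P, hP, hPl⟩⟩ := Ideal.nonempty_primesOver (S := B) l.head.asIdeal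
  obtain ⟨L, hL, -⟩ := Ideal.exists_ltSeries_of_hasGoingUp l P
  rw [← hL]
  exact le_iSup (fun L : LTSeries (PrimeSpectrum B) => (L.length : WithBot ℕ∞)) L

/-- The transcendence degree of a finitely generated domain is at most its Krull dimension. -/
theorem trdeg_le_of_ringKrullDim_le {K B : Type*} [Field K] [CommRing B] [IsDomain B] [Algebra K B]
    [Algebra.FiniteType K B] {m : ℕ} (h : ringKrullDim B ≤ m) : Algebra.trdeg K B ≤ m := by
  obtain ⟨s, g, hg, hgi⟩ := exists_integral_inj_algHom_of_fg K B
  let := g.toRingHom.toAlgebra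
  have : IsScalarTower K (MvPolynomial (Fin s) K) B :=
    IsScalarTower.of_algebraMap_eq fun a => (g.commutes a).symm
  have : FaithfulSMul (MvPolynomial (Fin s) K) B :=
    (faithfulSMul_iff_algebraMap_injective _ _).2 hg
  have : Algebra.IsIntegral (MvPolynomial (Fin s) K) B := ⟨hgi⟩
  have h1 := (ringKrullDim_le_of_isIntegral_of_injective (A := MvPolynomial (Fin s) K)
    (B := B)).trans h
  rw [MvPolynomial.ringKrullDim_of_isNoetherianRing, ringKrullDim_eq_zero_of_field, zero_add] at h1
  have h2 : s ≤ m := by simpa using h1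
  have h3 := lift_trdeg_add_eq K (MvPolynomial (Fin s) K) B
  rw [trdeg_eq_zero (R := MvPolynomial (Fin s) K) (A := B), MvPolynomial.trdeg_of_isDomain] at h3
  simp at h3
  rw [← h3]
  exact_mod_cast h2

theorem MvPolynomial.exists_eval_ne_zero {σ K : Type*} [Field K] [Infinite K]
    {P : MvPolynomial σ K} (hP : P ≠ 0) : ∃ a, eval a P ≠ 0 := by
  by_contra! h
  exact hP (MvPolynomial.funext fun a => by rw [h a, map_zero])

theorem MvPolynomial.eval_aeval {σ τ K : Type*} [CommRing K] (x : τ → K)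
    (f : σ → MvPolynomial τ K) (P : MvPolynomial σ K) :
    eval x (aeval f P) = eval (fun i => eval x (f i)) P := by
  have : (aeval x).comp (aeval f) = aeval fun i => eval x (f i) := by
    ext i
    simp [aeval_eq_eval]
  exact DFunLike.congr_fun this P

/-- If the general fibre of `Spec B → 𝔸^σ` has at most `d` points, then the elements of `B` have
degree at most `d` over the coordinate ring of `𝔸^σ`. -/
theorem natDegree_minpoly_le_of_encard_le {σ K B : Type*} [Field K] [IsAlgClosed K] [CharZero K]
    [CommRing B] [IsDomain B] [Algebra K B] [Algebra (MvPolynomial σ K) B]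
    [IsScalarTower K (MvPolynomial σ K) B] [FaithfulSMul (MvPolynomial σ K) B]
    [Algebra.IsAlgebraic (MvPolynomial σ K) B] [Algebra.FiniteType K B] {θ : B}
    (hθ : IsIntegral (MvPolynomial σ K) θ) {P : MvPolynomial σ K} (hP : P ≠ 0) {d : ℕ}
    (h : ∀ b : σ → K, eval b P ≠ 0 →
      {ψ : B →ₐ[K] K | ∀ i, ψ (algebraMap (MvPolynomial σ K) B (X i)) = b i}.encard ≤ d) :
    (minpoly (MvPolynomial σ K) θ).natDegree ≤ d := by
  classical
  have : Algebra.FiniteType (MvPolynomial σ K) B := .of_restrictScalars_finiteType K _ B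
  have hmonic := minpoly.monic hθ
  obtain ⟨g₁, hg₁, hext⟩ := exists_ringHom_extension_of_root_minpoly (K := K) hθ
  obtain ⟨g₂, hg₂, hsep⟩ := Polynomial.exists_separable_specialization (K := K) hmonic <| by
    have : CharZero (FractionRing (MvPolynomial σ K)) :=
      charZero_of_injective_algebraMap (IsFractionRing.injective (MvPolynomial σ K) _)
    exact ((hmonic.irreducible_iff_irreducible_map_fraction_map).1
      (minpoly.prime_of_isIntegrallyClosed hθ).irreducible).separable
  -- At this `b` the specialized minimal polynomial has distinct roots, each of them the value at
  -- `θ` of some point over `b`.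
  obtain ⟨b, hb⟩ := exists_eval_ne_zero (mul_ne_zero (mul_ne_zero hg₁ hg₂) hP)
  simp only [map_mul, mul_ne_zero_iff] at hb
  set p := (minpoly (MvPolynomial σ K) θ).map (eval b) with hp
  have hcard : p.roots.toFinset.card = p.natDegree := by
    rw [Multiset.toFinset_card_of_nodup (Polynomial.nodup_roots (hsep _ hb.1.2))]
    exact (IsAlgClosed.splits p).natDegree_eq_card_roots.symm
  have hsub : (p.roots.toFinset : Set K) ⊆ (fun ψ : B →ₐ[K] K => ψ θ) ''
      {ψ : B →ₐ[K] K | ∀ i, ψ (algebraMap (MvPolynomial σ K) B (X i)) = b i} := by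
    intro t ht
    have ht' : p.eval t = 0 := by
      have := Polynomial.isRoot_of_mem_roots (Multiset.mem_toFinset.1 ht)
      exact this
    obtain ⟨ψ, hψ, hψt⟩ := hext _ hb.1.1 t ht'
    have hψ' : ∀ x, ψ (algebraMap (MvPolynomial σ K) B x) = eval b x := RingHom.congr_fun hψ
    refine ⟨{ ψ with commutes' := fun r => ?_ }, fun i => (hψ' (X i)).trans (eval_X i), hψt⟩
    change ψ (algebraMap K B r) = r
    rw [IsScalarTower.algebraMap_apply K (MvPolynomial σ K) B, hψ', MvPolynomial.algebraMap_eq,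
      eval_C]
  have := (Set.encard_le_encard hsub).trans ((Set.encard_image_le _ _).trans (h b hb.2))
  rw [Set.encard_coe_eq_coe_finsetCard, hcard, hp, hmonic.natDegree_map] at this
  exact_mod_cast this

/-! ### Total degree, shears and leading forms -/

/-- Both degrees are additive and the first-variable degree never exceeds the total one, so equality
for a product forces equality for each factor. -/
theorem totalDegree_finSuccEquiv_symm_le_of_dvd {K : Type*} [Field K] {m : ℕ}
    {F : MvPolynomial (Fin (m + 1)) K} (hF : F ≠ 0)
    (hdeg : F.totalDegree ≤ (finSuccEquiv K m F).natDegree)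
    {f : Polynomial (MvPolynomial (Fin m) K)} (hf : f ∣ finSuccEquiv K m F) :
    ((finSuccEquiv K m).symm f).totalDegree ≤ f.natDegree := by
  obtain ⟨h, hh⟩ := hf
  obtain ⟨G, rfl⟩ := (finSuccEquiv K m).surjective f
  obtain ⟨H, rfl⟩ := (finSuccEquiv K m).surjective h
  rw [← map_mul] at hh
  obtain rfl := (finSuccEquiv K m).injective hh
  have hG : G ≠ 0 := left_ne_zero_of_mul hF
  have hH : H ≠ 0 := right_ne_zero_of_mul hF
  rw [totalDegree_mul_of_isDomain hG hH, map_mul, Polynomial.natDegree_mul (by simpa) (by simpa),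
    natDegree_finSuccEquiv H] at hdeg
  have := degreeOf_le_totalDegree H 0
  rw [AlgEquiv.symm_apply_apply]
  omega

theorem totalDegree_aeval_le {σ τ K : Type*} [CommRing K] (f : σ → MvPolynomial τ K)
    (hf : ∀ i, (f i).totalDegree ≤ 1) (F : MvPolynomial σ K) :
    (aeval f F).totalDegree ≤ F.totalDegree := by
  rw [aeval_def, eval₂_eq]
  refine totalDegree_finsetSum_le fun s hs => (totalDegree_mul _ _).trans ?_
  rw [MvPolynomial.algebraMap_eq, totalDegree_C, zero_add]
  refine (totalDegree_finsetProd _ _).trans (le_trans ?_ (le_totalDegree hs))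
  refine Finset.sum_le_sum fun i _ => (totalDegree_pow _ _).trans ?_
  simpa using Nat.mul_le_mul_left (s i) (hf i)

/-- The substitution `(T, z) ↦ (T, z + T c)`. -/
noncomputable def shear {K : Type*} [CommRing K] {m : ℕ} (c : Fin m → K) :
    MvPolynomial (Fin (m + 1)) K →ₐ[K] MvPolynomial (Fin (m + 1)) K :=
  aeval (Fin.cons (X 0) fun i => X i.succ + C (c i) * X 0)

section shear

variable {K : Type*} [CommRing K] {m : ℕ} (c : Fin m → K)

theorem eval_shear (v : Fin (m + 1) → K) (F : MvPolynomial (Fin (m + 1)) K) :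
    eval v (shear c F) = eval (Fin.cons (v 0) fun i => v i.succ + c i * v 0) F := by
  have : (aeval v).comp (shear c) = aeval (Fin.cons (v 0) fun i => v i.succ + c i * v 0) := by
    ext i
    refine Fin.cases ?_ (fun i => ?_) i <;> simp [shear]
  exact DFunLike.congr_fun this F

theorem shear_shear_neg (F : MvPolynomial (Fin (m + 1)) K) : shear c (shear (-c) F) = F := by
  have : (shear c).comp (shear (-c)) = AlgHom.id K _ := by
    ext i : 1
    refine Fin.cases ?_ (fun i => ?_) i <;> simp [shear]
  exact DFunLike.congr_fun this F

theorem shear_injective : Function.Injective (shear c) := fun F G h => by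
  have h1 := shear_shear_neg (-c) F
  rw [neg_neg, h] at h1
  rw [← h1]
  simpa using shear_shear_neg (-c) G

theorem totalDegree_shear_le [Nontrivial K] (F : MvPolynomial (Fin (m + 1)) K) :
    (shear c F).totalDegree ≤ F.totalDegree := by
  refine totalDegree_aeval_le _ (Fin.cases ?_ fun i => ?_) F
  · simp
  · refine (totalDegree_add _ _).trans (max_le (by simp) ?_)
    exact (totalDegree_mul _ _).trans (by simp)

end shear

theorem coeff_aeval_C_mul_X {σ K : Type*} [CommRing K] (w : σ → K) (F : MvPolynomial σ K) (n : ℕ) :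
    (aeval (fun i => Polynomial.C (w i) * Polynomial.X) F : Polynomial K).coeff n =
      eval w (homogeneousComponent n F) := by
  rw [homogeneousComponent_apply, map_sum, Finset.sum_filter, aeval_def, eval₂_eq,
    Polynomial.finsetSum_coeff]
  refine Finset.sum_congr rfl fun s _ => ?_
  simp_rw [mul_pow, Finset.prod_mul_distrib, Finset.prod_pow_eq_pow_sum, ← map_pow, ← map_prod,
    Polynomial.algebraMap_eq, ← mul_assoc, ← map_mul, Polynomial.coeff_C_mul_X_pow, eval_monomial,
    Finsupp.prod, Finsupp.degree_apply, @eq_comm _ n]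
  congr

theorem MvPolynomial.IsHomogeneous.eval_smul {σ K : Type*} [CommRing K] {H : MvPolynomial σ K}
    {e : ℕ} (hH : H.IsHomogeneous e) (r : K) (w : σ → K) : eval (r • w) H = r ^ e * eval w H := by
  rw [eval_eq, eval_eq, Finset.mul_sum]
  refine Finset.sum_congr rfl fun s hs => ?_
  have hs' : ∑ i ∈ s.support, s i = e := (hH.degree_eq_sum_deg_support hs).symm
  simp_rw [Pi.smul_apply, smul_eq_mul, mul_pow, Finset.prod_mul_distrib,
    Finset.prod_pow_eq_pow_sum, hs']
  ring

/-- After a general shear, a polynomial has a constant leading coefficient in the first variable. -/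
theorem exists_shear_coeff_ne_zero {K : Type*} [Field K] [Infinite K] {m : ℕ}
    {F : MvPolynomial (Fin (m + 1)) K} (hF : F ≠ 0) {P : MvPolynomial (Fin m) K} (hP : P ≠ 0) :
    ∃ c : Fin m → K, eval c P ≠ 0 ∧
      (finSuccEquiv K m (shear (-c) F)).coeff F.totalDegree ≠ 0 := by
  set e := F.totalDegree with he
  set H := homogeneousComponent e F with hH
  have hHom : H.IsHomogeneous e := homogeneousComponent_isHomogeneous e F
  have hH0 : H ≠ 0 := by
    obtain ⟨s, hs, hse⟩ := Finset.exists_mem_eq_sup F.support (support_nonempty.2 hF)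
      (fun s => s.sum fun _ n => n)
    have hs' : s.degree = e := hse.symm
    refine ne_of_apply_ne (coeff s) ?_
    rw [hH, coeff_homogeneousComponent, if_pos hs', coeff_zero]
    exact mem_support_iff.1 hs
  let w : MvPolynomial (Fin (m + 1)) K →ₐ[K] MvPolynomial (Fin m) K :=
    aeval (Fin.cons 1 fun i => -X i)
  have hw : ∀ c G, eval c (w G) = eval (Fin.cons 1 (-c)) G := fun c G => by
    have : (aeval c).comp w = aeval (Fin.cons 1 (-c)) := by
      ext i
      refine Fin.cases ?_ (fun i => ?_) i <;> simp [w]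
    exact DFunLike.congr_fun this G
  -- By homogeneity, a point with `v 0 ≠ 0` where `H` does not vanish rescales to first coordinate
  -- 1.
  have hw0 : w H ≠ 0 := by
    intro h0
    obtain ⟨v, hv⟩ := exists_eval_ne_zero (mul_ne_zero (X_ne_zero (R := K) (0 : Fin (m + 1))) hH0)
    rw [map_mul, eval_X, mul_ne_zero_iff] at hv
    refine hv.2 ?_
    have h1 := hw (fun i => -(v i.succ / v 0)) H
    rw [h0, map_zero] at h1
    have h2 : v = v 0 • (Fin.cons 1 (-fun i => -(v i.succ / v 0)) : Fin (m + 1) → K) := by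
      funext i
      refine Fin.cases ?_ (fun i => ?_) i
      · simp
      · simp [mul_div_cancel₀ _ hv.1]
    rw [h2, hHom.eval_smul, ← h1, mul_zero]
  obtain ⟨c, hc⟩ := exists_eval_ne_zero (mul_ne_zero hw0 hP)
  rw [map_mul, mul_ne_zero_iff, hw, hH, ← coeff_aeval_C_mul_X] at hc
  refine ⟨c, hc.2, fun h => hc.1 ?_⟩
  have hC : ∀ r, finSuccEquiv K m (C r) = Polynomial.C (C r) := fun r => by
    simp [finSuccEquiv_apply]
  -- Setting the other variables to 0 restricts `F` to the line spanned by `(1, -c)`, where the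
  -- coefficient in degree `e` is `H(1, -c)`.
  have h1 : ((finSuccEquiv K m (shear (-c) F)).map (eval 0)) =
      aeval (fun i => Polynomial.C ((Fin.cons 1 (-c) : Fin (m + 1) → K) i) * Polynomial.X) F := by
    have : ((Polynomial.mapAlgHom (aeval (0 : Fin m → K))).comp
        ((finSuccEquiv K m : _ →ₐ[K] _).comp (shear (-c)))) =
        aeval (fun i => Polynomial.C ((Fin.cons 1 (-c) : Fin (m + 1) → K) i) * Polynomial.X) := by
      ext i : 1
      refine Fin.cases ?_ (fun i => ?_) i <;> simp [shear, finSuccEquiv_X_zero, finSuccEquiv_X_succ, hC]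
    exact DFunLike.congr_fun this F
  rw [← h1, Polynomial.coeff_map, h, map_zero]

/-! ### Linear forms on an irreducible variety -/

/-- The linear form with coefficients `u`. -/
noncomputable def linearForm {τ K : Type*} [CommRing K] [Fintype τ] (u : τ → K) :
    MvPolynomial τ K :=
  ∑ j, C (u j) * X j

theorem eval_linearForm {τ K : Type*} [CommRing K] [Fintype τ] (u v : τ → K) :
    eval v (linearForm u) = u ⬝ᵥ v := by
  simp [linearForm, dotProduct]

section

variable {τ : Type*} [Fintype τ] (I : Ideal (MvPolynomial τ ℂ)) [hI : I.IsPrime]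

theorem aeval_mk_linearForm_eq_zero_iff {σ : Type*} (N : σ → τ → ℂ) (F : MvPolynomial σ ℂ) :
    aeval (fun i => Ideal.Quotient.mk I (linearForm (N i))) F = 0 ↔
      ∀ v ∈ zeroLocus ℂ I, eval (fun i => N i ⬝ᵥ v) F = 0 := by
  have h1 : aeval (fun i => Ideal.Quotient.mk I (linearForm (N i))) F =
      Ideal.Quotient.mk I (aeval (fun i => linearForm (N i)) F) := by
    have := DFunLike.congr_fun (MvPolynomial.comp_aeval (fun i => linearForm (N i))
      (Ideal.Quotient.mkₐ ℂ I)) F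
    exact this.symm
  have h2 : ∀ p, p ∈ I ↔ ∀ v ∈ zeroLocus ℂ I, eval v p = 0 := fun p => by
    conv_lhs => rw [← MvPolynomial.IsPrime.vanishingIdeal_zeroLocus (K := ℂ) I]
    rfl
  simp_rw [h1, Ideal.Quotient.eq_zero_iff_mem, h2, eval_aeval, eval_linearForm]

variable {I} {m : ℕ}

/-- More linear forms than the dimension satisfy a polynomial relation on a variety. -/
theorem exists_relation_linearForms (hdim : ringKrullDim (MvPolynomial τ ℂ ⧸ I) ≤ m)
    (N : Fin (m + 1) → τ → ℂ) :
    ∃ F : MvPolynomial (Fin (m + 1)) ℂ, F ≠ 0 ∧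
      ∀ v ∈ zeroLocus ℂ I, eval (fun i => N i ⬝ᵥ v) F = 0 := by
  by_contra! h
  have hind : AlgebraicIndependent ℂ fun i => Ideal.Quotient.mk I (linearForm (N i)) := by
    refine algebraicIndependent_iff.2 fun F hF => ?_
    by_contra hF0
    obtain ⟨v, hv, hv0⟩ := h F hF0
    exact hv0 ((aeval_mk_linearForm_eq_zero_iff I N F).1 hF v hv)
  have h1 := hind.lift_cardinalMk_le_trdeg
  have h2 := trdeg_le_of_ringKrullDim_le (K := ℂ) hdim
  have h3 := h1.trans (Cardinal.lift_le.2 h2)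
  simp only [Cardinal.mk_fin, Cardinal.lift_natCast, Nat.cast_le] at h3
  omega

/-- The `m` variables already use up the whole transcendence degree. -/
theorem isAlgebraic_of_faithfulSMul (hdim : ringKrullDim (MvPolynomial τ ℂ ⧸ I) ≤ m)
    [Algebra (MvPolynomial (Fin m) ℂ) (MvPolynomial τ ℂ ⧸ I)]
    [IsScalarTower ℂ (MvPolynomial (Fin m) ℂ) (MvPolynomial τ ℂ ⧸ I)]
    [FaithfulSMul (MvPolynomial (Fin m) ℂ) (MvPolynomial τ ℂ ⧸ I)] :
    Algebra.IsAlgebraic (MvPolynomial (Fin m) ℂ) (MvPolynomial τ ℂ ⧸ I) := by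
  have h1 := lift_trdeg_add_eq ℂ (MvPolynomial (Fin m) ℂ) (MvPolynomial τ ℂ ⧸ I)
  have h2 := trdeg_le_of_ringKrullDim_le (K := ℂ) hdim
  rw [MvPolynomial.trdeg_of_isDomain] at h1
  simp only [Cardinal.mk_fin, Cardinal.lift_natCast] at h1
  simp only [Cardinal.lift_id'] at h1
  rw [← h1, add_comm, ← zero_add (m : Cardinal), ← add_assoc, Cardinal.add_nat_le_add_nat_iff,
    add_zero, nonpos_iff_eq_zero] at h2
  exact trdeg_eq_zero_iff.1 h2

end

/-! ### From general linear forms to all linear forms -/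

theorem Module.Basis.of_dual_mulVec_repr {ι κ K W : Type*} [Fintype ι] [Field K] [AddCommGroup W]
    [Module K W] (e : Module.Basis ι K W) (L : κ → Module.Dual K W) (F : W) :
    (Matrix.of fun j i => L j (e i)).mulVec (e.repr F) = fun j => L j F := by
  ext j
  conv_rhs => rw [← e.sum_repr F, map_sum]
  refine Finset.sum_congr rfl fun i _ => ?_
  rw [map_smul, smul_eq_mul, mul_comm]
  rfl

/-- A family of functionals separating points contains, up to repetition, a dual basis. -/
theorem exists_det_dual_ne_zero {ι K W : Type*} [Field K] [AddCommGroup W] [Module K W]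
    [FiniteDimensional K W] (L : ι → Module.Dual K W) (hL : ∀ F, F ≠ 0 → ∃ v, L v F ≠ 0) :
    ∃ (r : ℕ) (e : Module.Basis (Fin r) K W) (a : Fin r → ι),
      (Matrix.of fun j i => L (a j) (e i)).det ≠ 0 := by
  obtain ⟨κ, a, -, hspan, hind⟩ := exists_linearIndependent' K L
  have htop : Submodule.span K (Set.range L) = ⊤ := Submodule.span_eq_top_of_ne_zero fun F hF => by
    obtain ⟨v, hv⟩ := hL F hF
    exact ⟨_, ⟨v, rfl⟩, hv⟩
  let b := Module.Basis.mk hind (hspan.trans htop).ge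
  let ε : κ ≃ Fin (Module.finrank K W) :=
    b.indexEquiv (Module.finBasis K W).dualBasis
  refine ⟨_, Module.finBasis K W, a ∘ ε.symm, fun h0 => ?_⟩
  obtain ⟨x, hx, hx0⟩ := Matrix.exists_mulVec_eq_zero_iff.2 h0
  set F := (Module.finBasis K W).equivFun.symm x with hF
  have hFx : ⇑((Module.finBasis K W).repr F) = x := (Module.finBasis K W).equivFun.apply_symm_apply x
  rw [← hFx, Module.Basis.of_dual_mulVec_repr] at hx0
  have hF0 : F ≠ 0 := by
    simpa only [hF, ne_eq, LinearEquiv.map_eq_zero_iff] using hx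
  obtain ⟨v, hv⟩ := hL F hF0
  have hle : Submodule.span K (Set.range L) ≤ LinearMap.ker (Module.Dual.eval K W F) := by
    rw [← hspan, Submodule.span_le]
    rintro _ ⟨j, rfl⟩
    simpa using congrFun hx0 (ε j)
  exact hv (hle (Submodule.subset_span ⟨v, rfl⟩))

/-- If for general linear forms there is a polynomial relation of degree at most `d` on `V`, then
there is one for all linear forms. -/
theorem exists_relation_of_general {σ τ K : Type*} [Finite σ] [Fintype τ] [Field K] [Infinite K]
    {V : Set (τ → K)} {d : ℕ} {Q : MvPolynomial (σ × τ) K} (hQ : Q ≠ 0)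
    (h : ∀ N : σ → τ → K, eval (Function.uncurry N) Q ≠ 0 → ∃ F : MvPolynomial σ K, F ≠ 0 ∧
      F.totalDegree ≤ d ∧ ∀ v ∈ V, eval (fun i => N i ⬝ᵥ v) F = 0) (N : σ → τ → K) :
    ∃ F : MvPolynomial σ K, F ≠ 0 ∧
      F.totalDegree ≤ d ∧ ∀ v ∈ V, eval (fun i => N i ⬝ᵥ v) F = 0 := by
  by_contra! hN
  let L : (σ → τ → K) → V → Module.Dual K (restrictTotalDegree σ K d) := fun N v =>
    (aeval (fun i => N i ⬝ᵥ v.1) : MvPolynomial σ K →ₐ[K] K).toLinearMap ∘ₗ Submodule.subtype _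
  have hL : ∀ N v F, L N v F = eval (fun i => N i ⬝ᵥ v.1) F.1 := fun N v F => rfl
  obtain ⟨r, e, a, hdet⟩ := exists_det_dual_ne_zero (L N) fun F hF => by
    obtain ⟨v, hv, hne⟩ := hN F.1 (by simpa using hF) ((mem_restrictTotalDegree _ _ _).1 F.2)
    exact ⟨⟨v, hv⟩, hne⟩
  -- With the points `a j` fixed and the forms generic, the determinant is a polynomial in the
  -- forms; where it is nonzero no relation exists.
  let D : Matrix (Fin r) (Fin r) (MvPolynomial (σ × τ) K) := Matrix.of fun j i =>
    aeval (fun s => ∑ t, X (s, t) * C ((a j).1 t)) (e i).1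
  have hD : ∀ N' : σ → τ → K, eval (Function.uncurry N') D.det =
      (Matrix.of fun j i => L N' (a j) (e i)).det := fun N' => by
    rw [RingHom.map_det]
    congr 1
    ext j i
    change eval _ (aeval _ _) = eval _ _
    rw [eval_aeval]
    congr 2
    ext s
    simp [dotProduct]
  have hD0 : D.det ≠ 0 := fun h0 => hdet (by rw [← hD, h0, map_zero])
  obtain ⟨z, hz⟩ := exists_eval_ne_zero (mul_ne_zero hQ hD0)
  obtain ⟨N', rfl⟩ : ∃ N', Function.uncurry N' = z := ⟨_, Function.uncurry_curry z⟩
  rw [map_mul, mul_ne_zero_iff, hD] at hz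
  obtain ⟨F, hF0, hFd, hF⟩ := h N' hz.1
  have hFW := (mem_restrictTotalDegree _ _ _).2 hFd
  refine hz.2 (Matrix.exists_mulVec_eq_zero_iff.1 ⟨e.repr ⟨F, hFW⟩, ?_, ?_⟩)
  · intro h0
    have h1 : (⟨F, hFW⟩ : restrictTotalDegree σ K d) = 0 :=
      e.ext_elem fun i => by rw [h0, map_zero]; rfl
    exact hF0 ((Submodule.mk_eq_zero _ _).1 h1)
  · rw [Module.Basis.of_dual_mulVec_repr e fun j => L N' (a j)]
    funext j
    rw [hL]
    exact hF (a j) (a j).2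

/-! ### The relation of degree at most `d` -/

section

variable {τ : Type*} [Fintype τ] {I : Ideal (MvPolynomial τ ℂ)} {m : ℕ}

/-- The algebra homomorphisms from the coordinate ring of a variety to `ℂ` with prescribed values
at given linear forms are at most as many as the points of the corresponding linear section. -/
theorem encard_algHom_le_encard_linearSection (M : Fin m → τ → ℂ) (b : Fin m → ℂ) :
    {ψ : MvPolynomial τ ℂ ⧸ I →ₐ[ℂ] ℂ |
      ∀ i, ψ (Ideal.Quotient.mk I (linearForm (M i))) = b i}.encard ≤
    (linearSection (zeroLocus ℂ I) (Sum.elim (Function.uncurry M) b)).encard := by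
  have hev : ∀ (ψ : MvPolynomial τ ℂ ⧸ I →ₐ[ℂ] ℂ) p,
      ψ (Ideal.Quotient.mk I p) = eval (fun j => ψ (Ideal.Quotient.mk I (X j))) p := fun ψ p => by
    have : ψ.comp (Ideal.Quotient.mkₐ ℂ I) =
        aeval fun j => ψ (Ideal.Quotient.mk I (X j)) := by
      ext j
      simp
    exact DFunLike.congr_fun this p
  refine Set.encard_le_encard_of_injOn
    (f := fun ψ j => ψ (Ideal.Quotient.mk I (X j))) (fun ψ hψ => ⟨fun p hp => ?_, fun i => ?_⟩) ?_
  · refine (hev ψ p).symm.trans ?_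
    rw [Ideal.Quotient.eq_zero_iff_mem.2 hp, map_zero]
  · have := hψ i
    rw [hev, eval_linearForm] at this
    exact this
  · intro ψ _ ψ' _ h
    refine Ideal.Quotient.algHom_ext ℂ (MvPolynomial.algHom_ext fun j => ?_)
    exact congrFun h j

variable {d : ℕ} {P : MvPolynomial ((Fin m × τ) ⊕ Fin m) ℂ}

/-- If the general linear section of codimension `m` has `d` points, then general linear forms
`θ, M` satisfy a polynomial relation of degree at most `d`. -/
theorem exists_relation_of_eval_ne_zero [hI : I.IsPrime]
    (hdim : ringKrullDim (MvPolynomial τ ℂ ⧸ I) ≤ m) (hd : 0 < d)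
    (hP : ∀ a, eval a P ≠ 0 → (linearSection (zeroLocus ℂ I) a).encard = d)
    (θ : τ → ℂ) (M : Fin m → τ → ℂ) (b : Fin m → ℂ)
    (hb : eval (Sum.elim (Function.uncurry M) b) P ≠ 0) :
    ∃ G : MvPolynomial (Fin (m + 1)) ℂ, G ≠ 0 ∧ G.totalDegree ≤ d ∧
      ∀ v ∈ zeroLocus ℂ I, eval (fun i => (Fin.cons θ M : Fin (m + 1) → τ → ℂ) i ⬝ᵥ v) G = 0 := by
  obtain ⟨F, hF0, hF⟩ := exists_relation_linearForms hdim (Fin.cons θ M)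
  -- The shear parameter `c` is chosen to make `θ` integral over the forms `M' c` while keeping
  -- their sections general.
  let M' : (Fin m → ℂ) → Fin m → τ → ℂ := fun c i => M i + c i • θ
  have hPc : aeval (Sum.elim (fun ij => C (M ij.1 ij.2) + C (θ ij.2) * X ij.1) fun i => C (b i)) P
      ≠ (0 : MvPolynomial (Fin m) ℂ) := fun h0 => hb <| by
    have h1 := congrArg (eval 0) h0
    rw [eval_aeval, map_zero] at h1
    rw [← h1]
    congr 2
    ext i
    rcases i with ⟨i, j⟩ | i <;> simp
  obtain ⟨c, hc, hcF⟩ := exists_shear_coeff_ne_zero hF0 hPc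
  rw [eval_aeval] at hc
  set F' := shear (-c) F with hF'
  have hPb : aeval (Sum.elim (fun ij => C (M' c ij.1 ij.2)) X) P ≠ (0 : MvPolynomial (Fin m) ℂ) :=
    fun h0 => hc <| by
      have h1 := congrArg (eval b) h0
      rw [eval_aeval, map_zero] at h1
      rw [← h1]
      congr 2
      ext i
      rcases i with ⟨i, j⟩ | i <;> simp [M', mul_comm]
  have hPM : ∀ b', eval b' (aeval (Sum.elim (fun ij => C (M' c ij.1 ij.2)) X) P) =
      eval (Sum.elim (Function.uncurry (M' c)) b') P := fun b' => by
    rw [eval_aeval]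
    congr 2
    ext i
    rcases i with ⟨i, j⟩ | i <;> simp
  have hdot : ∀ v, (Fin.cons (θ ⬝ᵥ v) fun i => M' c i ⬝ᵥ v : Fin (m + 1) → ℂ) =
      fun i => (Fin.cons θ (M' c) : Fin (m + 1) → τ → ℂ) i ⬝ᵥ v := fun v => by
    funext i
    refine Fin.cases ?_ (fun i => ?_) i <;> simp
  have hshear : ∀ v G, eval (fun i => (Fin.cons θ M : Fin (m + 1) → τ → ℂ) i ⬝ᵥ v) (shear c G) =
      eval (fun i => (Fin.cons θ (M' c) : Fin (m + 1) → τ → ℂ) i ⬝ᵥ v) G := fun v G => by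
    rw [eval_shear, ← hdot]
    congr 2
    funext i
    simp [M', add_dotProduct]
  let α : MvPolynomial (Fin m) ℂ →ₐ[ℂ] MvPolynomial τ ℂ ⧸ I :=
    aeval fun i => Ideal.Quotient.mk I (linearForm (M' c i))
  let := α.toRingHom.toAlgebra
  have halg : ∀ p, algebraMap (MvPolynomial (Fin m) ℂ) (MvPolynomial τ ℂ ⧸ I) p = α p := fun p => rfl
  have : IsScalarTower ℂ (MvPolynomial (Fin m) ℂ) (MvPolynomial τ ℂ ⧸ I) :=
    IsScalarTower.of_algebraMap_eq fun r => (α.commutes r).symm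
  -- General values `b'` are attained on `V` because `d > 0`, so the forms `M' c` are algebraically
  -- independent there.
  have : FaithfulSMul (MvPolynomial (Fin m) ℂ) (MvPolynomial τ ℂ ⧸ I) := by
    rw [faithfulSMul_iff_algebraMap_injective, injective_iff_map_eq_zero]
    intro p hp
    rw [halg, aeval_mk_linearForm_eq_zero_iff] at hp
    by_contra hp0
    obtain ⟨b', hb'⟩ := exists_eval_ne_zero (mul_ne_zero hp0 hPb)
    rw [map_mul, mul_ne_zero_iff, hPM] at hb'
    have hne : (linearSection (zeroLocus ℂ I) (Sum.elim (Function.uncurry (M' c)) b')).Nonempty := by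
      rw [← Set.encard_pos, hP _ hb'.2]
      exact_mod_cast hd
    obtain ⟨v, hv, hvb⟩ := hne
    refine hb'.1 ?_
    have : (fun i => M' c i ⬝ᵥ v) = b' := funext hvb
    rw [← this]
    exact hp v hv
  have := isAlgebraic_of_faithfulSMul hdim
  set θ' := Ideal.Quotient.mk I (linearForm θ) with hθ'
  have haeval : ∀ G, Polynomial.aeval θ' (finSuccEquiv ℂ m G) =
      aeval (fun i => Ideal.Quotient.mk I
        (linearForm ((Fin.cons θ (M' c) : Fin (m + 1) → τ → ℂ) i))) G := fun G => by
    have : (((Polynomial.aeval θ' : Polynomial (MvPolynomial (Fin m) ℂ) →ₐ[_] _).restrictScalars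
        ℂ).comp (finSuccEquiv ℂ m : _ →ₐ[ℂ] _)) = aeval (fun i => Ideal.Quotient.mk I
        (linearForm ((Fin.cons θ (M' c) : Fin (m + 1) → τ → ℂ) i))) := by
      ext i
      refine Fin.cases ?_ (fun i => ?_) i
      · simp [finSuccEquiv_X_zero, hθ']
      · simp [finSuccEquiv_X_succ, halg, α]
    exact DFunLike.congr_fun this G
  have hF'V : Polynomial.aeval θ' (finSuccEquiv ℂ m F') = 0 := by
    rw [haeval, aeval_mk_linearForm_eq_zero_iff]
    intro v hv
    rw [← hshear, hF', shear_shear_neg]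
    exact hF v hv
  have hF'0 : F' ≠ 0 := fun h0 => hF0 <| shear_injective (-c) (by rw [← hF', h0, map_zero])
  have hle : F'.totalDegree ≤ F.totalDegree := totalDegree_shear_le _ F
  have hdegF : (finSuccEquiv ℂ m F').natDegree = F.totalDegree :=
    le_antisymm ((natDegree_finSuccEquiv F').trans_le ((degreeOf_le_totalDegree _ _).trans hle))
      (Polynomial.le_natDegree_of_ne_zero hcF)
  have hint : IsIntegral (MvPolynomial (Fin m) ℂ) θ' := by
    have h1 := totalDegree_coeff_finSuccEquiv_add_le F' _ hcF
    have h2 := totalDegree_eq_zero_iff_eq_C.1 (by omega :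
      ((finSuccEquiv ℂ m F').coeff F.totalDegree).totalDegree = 0)
    rw [h2] at hcF
    set r := ((finSuccEquiv ℂ m F').coeff F.totalDegree).coeff 0 with hr
    have hr0 : r ≠ 0 := fun h0 => hcF (by rw [h0, C_0])
    refine ⟨Polynomial.C (C r⁻¹) * finSuccEquiv ℂ m F', ?_, ?_⟩
    · apply Polynomial.monic_C_mul_of_mul_leadingCoeff_eq_one
      rw [Polynomial.leadingCoeff, hdegF, h2, ← C_mul, inv_mul_cancel₀ hr0, C_1]
    · rw [← Polynomial.aeval_def, map_mul, hF'V, mul_zero]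
  refine ⟨shear c ((finSuccEquiv ℂ m).symm (minpoly (MvPolynomial (Fin m) ℂ) θ')), ?_, ?_, ?_⟩
  · rw [Ne, map_eq_zero_iff _ (shear_injective c), EmbeddingLike.map_eq_zero_iff]
    exact minpoly.ne_zero hint
  · refine (totalDegree_shear_le _ _).trans ((totalDegree_finSuccEquiv_symm_le_of_dvd hF'0
      (hle.trans hdegF.ge) (minpoly.isIntegrallyClosed_dvd hint hF'V)).trans ?_)
    refine natDegree_minpoly_le_of_encard_le hint hPb fun b' hb' => ?_
    rw [hPM] at hb'
    rw [← hP _ hb']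
    refine le_trans (le_of_eq ?_) (encard_algHom_le_encard_linearSection _ _)
    simp [halg, α]
  · intro v hv
    rw [hshear]
    refine (aeval_mk_linearForm_eq_zero_iff I _ _).1 ?_ v hv
    rw [← haeval, AlgEquiv.apply_symm_apply, minpoly.aeval]

/-- If the general linear section of codimension `m` has `d` points, then any `m + 1` linear forms
satisfy a polynomial relation of degree at most `d`. -/
theorem exists_relation_of_forGeneral [hI : I.IsPrime]
    (hdim : ringKrullDim (MvPolynomial τ ℂ ⧸ I) ≤ m) (hd : 0 < d)
    (h : ForGeneral fun a : (Fin m × τ) ⊕ Fin m → ℂ =>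
      (linearSection (zeroLocus ℂ I) a).encard = d)
    (N : Fin (m + 1) → τ → ℂ) :
    ∃ G : MvPolynomial (Fin (m + 1)) ℂ, G ≠ 0 ∧ G.totalDegree ≤ d ∧
      ∀ v ∈ zeroLocus ℂ I, eval (fun i => N i ⬝ᵥ v) G = 0 := by
  obtain ⟨P, hP0, hP⟩ := h
  obtain ⟨a, ha⟩ := exists_eval_ne_zero hP0
  let f : (Fin m × τ) ⊕ Fin m → MvPolynomial (Fin (m + 1) × τ) ℂ :=
    Sum.elim (fun ij => X (ij.1.succ, ij.2)) fun i => C (a (Sum.inr i))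
  have hf : ∀ N : Fin (m + 1) → τ → ℂ, eval (Function.uncurry N) (aeval f P) =
      eval (Sum.elim (Function.uncurry (Fin.tail N)) fun i => a (Sum.inr i)) P := fun N => by
    rw [eval_aeval]
    congr 2
    ext i
    rcases i with ⟨i, j⟩ | i <;> simp [f, Fin.tail]
  -- The right-hand sides are frozen at those of `a`, leaving a nonzero condition on the forms
  -- alone; row 0 of `N` is unconstrained.
  refine exists_relation_of_general (Q := aeval f P) (fun h0 => ha ?_) (fun N hN => ?_) N
  · have h1 := hf (Fin.cons 0 fun i j => a (Sum.inl (i, j)))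
    rw [h0, map_zero, Fin.tail_cons] at h1
    rw [h1]
    congr 2
    ext i
    rcases i with ⟨i, j⟩ | i <;> simp
  · rw [hf] at hN
    have := exists_relation_of_eval_ne_zero hdim hd hP (N 0) (Fin.tail N) _ hN
    rwa [Fin.cons_self_tail] at this

end

/-! ### Vieta's formula and the moment curve -/

theorem Polynomial.coeff_eq_neg_mul_sum_of_card_eq {K : Type*} [Field K] {q : Polynomial K}
    (hq : q ≠ 0) {d : ℕ} (hd : 0 < d) (hdeg : q.natDegree ≤ d) {T : Finset K} (hT : T.card = d)
    (hroot : ∀ t ∈ T, q.eval t = 0) :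
    q.coeff d ≠ 0 ∧ q.coeff (d - 1) = -(q.coeff d) * ∑ t ∈ T, t := by
  have hle : T.val ≤ q.roots := (Multiset.le_iff_subset T.nodup).2 fun t ht =>
    (Polynomial.mem_roots hq).2 (hroot t ht)
  have hc := Polynomial.card_roots' q
  have hval : T.val.card = d := hT
  have heq : T.val = q.roots := Multiset.eq_of_le_of_card_le hle (by omega)
  rw [← heq] at hc
  have hnat : q.natDegree = d := by omega
  have hsplit : q.Splits := Polynomial.splits_iff_card_roots.2 (by rw [← heq]; omega)
  have hlead : q.coeff d = q.leadingCoeff := by rw [Polynomial.leadingCoeff, hnat]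
  refine ⟨by rwa [hlead, Ne, Polynomial.leadingCoeff_eq_zero], ?_⟩
  have h1 := hsplit.nextCoeff_eq_neg_sum_roots_mul_leadingCoeff
  rw [Polynomial.nextCoeff_of_natDegree_pos (by omega), hnat, ← heq] at h1
  rw [h1, hlead, Finset.sum_val]
  rfl

/-- The vector `(1, s, …, s^(k-1))`. -/
def momentVector {K : Type*} [Monoid K] (k : ℕ) (s : K) : Fin k → K := fun j => s ^ (j : ℕ)

/-- The polynomial `∑ j, x j * s ^ j` in `s`. -/
noncomputable def momentPolynomial {K : Type*} [Field K] {k : ℕ} (x : Fin k → K) : Polynomial K :=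
  ∑ j, Polynomial.C (x j) * Polynomial.X ^ (j : ℕ)

section moment

variable {K : Type*} [Field K] {k : ℕ}

theorem eval_momentPolynomial (x : Fin k → K) (s : K) :
    (momentPolynomial x).eval s = momentVector k s ⬝ᵥ x := by
  rw [momentPolynomial, Polynomial.eval_finsetSum]
  refine Finset.sum_congr rfl fun j _ => ?_
  rw [Polynomial.eval_mul, Polynomial.eval_C, Polynomial.eval_pow, Polynomial.eval_X, mul_comm,
    momentVector]

theorem natDegree_momentPolynomial_le (x : Fin k → K) : (momentPolynomial x).natDegree ≤ k :=
  Polynomial.natDegree_sum_le_of_forall_le _ _ fun j _ =>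
    (Polynomial.natDegree_C_mul_X_pow_le _ _).trans j.2.le

theorem momentPolynomial_ne_zero {x : Fin k → K} (hx : x ≠ 0) : momentPolynomial x ≠ 0 := by
  contrapose! hx
  ext j
  have h := congrArg (Polynomial.coeff · (j : ℕ)) hx
  simpa [momentPolynomial, Polynomial.finsetSum_coeff, Polynomial.coeff_C_mul, Polynomial.coeff_X_pow,
    Fin.val_inj] using h

/-- All but boundedly many vectors on the moment curve separate the points of a finite set. -/
theorem exists_polynomial_injOn (T : Finset (Fin k → K)) :
    ∃ R : Polynomial K, R ≠ 0 ∧ R.natDegree ≤ T.card * T.card * k ∧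
      ∀ s, R.eval s ≠ 0 → Set.InjOn (fun x => momentVector k s ⬝ᵥ x) T := by
  classical
  refine ⟨∏ z ∈ T.offDiag, momentPolynomial (z.1 - z.2), ?_, ?_, fun s hs x hx y hy hxy => ?_⟩
  · refine Finset.prod_ne_zero_iff.2 fun z hz => momentPolynomial_ne_zero ?_
    exact sub_ne_zero.2 (Finset.mem_offDiag.1 hz).2.2
  · refine (Polynomial.natDegree_prod_le _ _).trans ?_
    refine (Finset.sum_le_card_nsmul _ _ k fun z _ => natDegree_momentPolynomial_le _).trans ?_
    rw [Finset.offDiag_card, smul_eq_mul]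
    exact Nat.mul_le_mul_right _ (Nat.sub_le _ _)
  · by_contra hne
    rw [Polynomial.eval_prod, Finset.prod_ne_zero_iff] at hs
    refine hs (x, y) (Finset.mem_offDiag.2 ⟨hx, hy, hne⟩) ?_
    rw [eval_momentPolynomial, dotProduct_sub]
    exact sub_eq_zero.2 hxy

end moment

/-! ### Sums over fibers along a line -/

theorem exists_eval_linePoint_eq {m : ℕ} {g : MvPolynomial (Fin m) ℂ} (hg : g.totalDegree ≤ 1)
    (p q : Fin m → ℂ) : ∃ α β : ℂ, ∀ t, eval (linePoint p q t) g = t * α + β := by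
  have h1 := MvPolynomial.aeval_natDegree_le g hg
    (fun i => Polynomial.C (p i) + Polynomial.C (q i) * Polynomial.X) (n := 1) fun i => by compute_degree
  obtain ⟨α, β, h⟩ := Polynomial.exists_eq_X_add_C_of_natDegree_le_one h1
  refine ⟨α, β, fun t => ?_⟩
  have h2 := congrArg (Polynomial.eval t) h
  have h3 : (Polynomial.aeval t).comp
      (aeval fun i => Polynomial.C (p i) + Polynomial.C (q i) * Polynomial.X) =
      (aeval (linePoint p q t) : MvPolynomial (Fin m) ℂ →ₐ[ℂ] ℂ) := by
    ext i
    simp [linePoint]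
    ring
  have h4 := DFunLike.congr_fun h3 g
  refine h4.symm.trans (h2.trans ?_)
  simp
  ring

/-- This form of affineness is one vector identity per triple, so it can be tested against linear
forms. -/
theorem exists_affine_of_three_points {K W : Type*} [Field K] [AddCommGroup W] [Module K W]
    {A : Set K} {f : K → W}
    (h : ∀ a ∈ A, ∀ b ∈ A, ∀ c ∈ A, (b - c) • f a + (c - a) • f b + (a - b) • f c = 0) :
    ∃ c₀ c₁ : W, ∀ t ∈ A, f t = t • c₀ + c₁ := by
  rcases A.subsingleton_or_nontrivial with hA | ⟨a, ha, b, hb, hab⟩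
  · rcases A.eq_empty_or_nonempty with rfl | ⟨a, ha⟩
    · exact ⟨0, 0, fun t ht => ht.elim⟩
    · exact ⟨0, f a, fun t ht => by rw [hA ht ha, smul_zero, zero_add]⟩
  · have hab' : a - b ≠ 0 := sub_ne_zero.2 hab
    refine ⟨(a - b)⁻¹ • (f a - f b), f a - a • (a - b)⁻¹ • (f a - f b), fun t ht => ?_⟩
    have h1 := h a ha b hb t ht
    apply smul_right_injective W hab'
    simp only
    rw [← sub_eq_zero, ← h1]
    match_scalars <;> field_simp <;> ring

section

variable {k m : ℕ} {V : Set (Fin k ⊕ Fin m → ℂ)} {d : ℕ}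

theorem exists_relation_momentVector {I : Ideal (MvPolynomial (Fin k ⊕ Fin m) ℂ)} [I.IsPrime]
    (hdim : ringKrullDim (MvPolynomial (Fin k ⊕ Fin m) ℂ ⧸ I) ≤ m) (hd : 0 < d)
    (h : ForGeneral fun a : (Fin m × (Fin k ⊕ Fin m)) ⊕ Fin m → ℂ =>
      (linearSection (zeroLocus ℂ I) a).encard = d) (u : Fin k → ℂ) :
    ∃ G : MvPolynomial (Fin (m + 1)) ℂ, G ≠ 0 ∧ G.totalDegree ≤ d ∧
      ∀ y, ∀ x ∈ fiber (zeroLocus ℂ I) y,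
        ((finSuccEquiv ℂ m G).map (eval y)).eval (u ⬝ᵥ x) = 0 := by
  obtain ⟨G, hG0, hGd, hG⟩ := exists_relation_of_forGeneral hdim hd h
    (Fin.cons (Sum.elim u 0) fun i => Pi.single (Sum.inr i) 1)
  refine ⟨G, hG0, hGd, fun y x hx => ?_⟩
  rw [← eval_eq_eval_mv_eval']
  convert hG _ hx using 3
  funext i
  refine Fin.cases ?_ (fun i => ?_) i
  · simp
  · simp

theorem natDegree_map_finSuccEquiv_le {G : MvPolynomial (Fin (m + 1)) ℂ} (hG : G.totalDegree ≤ d)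
    (y : Fin m → ℂ) : ((finSuccEquiv ℂ m G).map (eval y)).natDegree ≤ d :=
  Polynomial.natDegree_map_le.trans
    ((natDegree_finSuccEquiv G).trans_le ((degreeOf_le_totalDegree _ _).trans hG))

/-- For a family of relations `G s` between `momentVector k s ⬝ᵥ x` and `y` on a variety whose
general fibre has `d` points, all but finitely many have degree `d` in the first variable. -/
theorem finite_setOf_coeff_eq_zero (hd : 0 < d) (hV : ForGeneral fun y => (fiber V y).encard = d)
    {G : ℂ → MvPolynomial (Fin (m + 1)) ℂ} (hG0 : ∀ s, G s ≠ 0) (hGd : ∀ s, (G s).totalDegree ≤ d)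
    (hG : ∀ s y, ∀ x ∈ fiber V y,
      ((finSuccEquiv ℂ m (G s)).map (eval y)).eval (momentVector k s ⬝ᵥ x) = 0) :
    {s | (finSuccEquiv ℂ m (G s)).coeff d = 0}.Finite := by
  classical
  by_contra hinf
  -- The fiber is chosen after `B`; `d * d * k` bounds the non-separating parameters uniformly over
  -- fibers of `d` points.
  obtain ⟨B, hBsub, hB⟩ := Set.Infinite.exists_subset_card_eq hinf (d * d * k + 1)
  obtain ⟨P, hP0, hP⟩ := hV
  have hl : ∀ s, (finSuccEquiv ℂ m (G s)).leadingCoeff ≠ 0 := fun s => by simpa using hG0 s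
  obtain ⟨y, hy⟩ := exists_eval_ne_zero
    (mul_ne_zero hP0 (Finset.prod_ne_zero_iff (s := B).2 fun s _ => hl s))
  rw [map_mul, mul_ne_zero_iff, map_prod, Finset.prod_ne_zero_iff] at hy
  have hcard : (fiber V y).encard = d := hP y hy.1
  obtain ⟨T, hT⟩ := (Set.finite_of_encard_eq_coe hcard).exists_finset_coe
  rw [← hT, Set.encard_coe_eq_coe_finsetCard, Nat.cast_inj] at hcard
  obtain ⟨R, hR0, hRd, hR⟩ := exists_polynomial_injOn T
  obtain ⟨s, hsB, hs⟩ : ∃ s ∈ B, R.eval s ≠ 0 := by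
    by_contra! h0
    have := Finset.card_le_card (show B ⊆ R.roots.toFinset from fun s hs =>
      Multiset.mem_toFinset.2 ((Polynomial.mem_roots hR0).2 (h0 s hs)))
    have h2 := R.roots.toFinset_card_le
    have h3 := R.card_roots'
    rw [hcard] at hRd
    omega
  have hne : (finSuccEquiv ℂ m (G s)).map (eval y) ≠ 0 := fun h0 => hy.2 s hsB <| by
    rw [Polynomial.leadingCoeff, ← Polynomial.coeff_map, h0, Polynomial.coeff_zero]
  have := (Polynomial.coeff_eq_neg_mul_sum_of_card_eq hne hd
    (natDegree_map_finSuccEquiv_le (hGd s) y)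
    (T := T.image fun x => momentVector k s ⬝ᵥ x)
    (by rw [Finset.card_image_of_injOn (hR s hs), hcard]) (by
      simp only [Finset.forall_mem_image]
      exact fun x hx => hG s y x (hT ▸ Finset.mem_coe.2 hx))).1
  rw [Polynomial.coeff_map, show (finSuccEquiv ℂ m (G s)).coeff d = 0 from hBsub hsB,
    map_zero] at this
  exact this rfl

/-- Along a line, the sum of a linear form over separated fibres of `d` points is affine. -/
theorem exists_affine_sum {G : MvPolynomial (Fin (m + 1)) ℂ} (hd : 0 < d)
    (hGd : G.totalDegree ≤ d) (hGc : (finSuccEquiv ℂ m G).coeff d ≠ 0) {u : Fin k → ℂ}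
    (hG : ∀ y, ∀ x ∈ fiber V y, ((finSuccEquiv ℂ m G).map (eval y)).eval (u ⬝ᵥ x) = 0)
    (p q : Fin m → ℂ) :
    ∃ α β : ℂ, ∀ (t : ℂ) (T : Finset (Fin k → ℂ)), (T : Set _) = fiber V (linePoint p q t) →
      T.card = d → Set.InjOn (fun x => u ⬝ᵥ x) T → u ⬝ᵥ ∑ x ∈ T, x = t * α + β := by
  classical
  have h1 := totalDegree_coeff_finSuccEquiv_add_le G d hGc
  have h2 := totalDegree_eq_zero_iff_eq_C.1
    (by omega : ((finSuccEquiv ℂ m G).coeff d).totalDegree = 0)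
  set r := ((finSuccEquiv ℂ m G).coeff d).coeff 0 with hr
  have hr0 : r ≠ 0 := fun h0 => hGc (by rw [h2, h0, C_0])
  have h3 : ((finSuccEquiv ℂ m G).coeff (d - 1)).totalDegree ≤ 1 := by
    by_cases h0 : (finSuccEquiv ℂ m G).coeff (d - 1) = 0
    · simp [h0]
    · have := totalDegree_coeff_finSuccEquiv_add_le G (d - 1) h0
      omega
  obtain ⟨α, β, h⟩ := exists_eval_linePoint_eq h3 p q
  refine ⟨-r⁻¹ * α, -r⁻¹ * β, fun t T hT hTc hinj => ?_⟩
  have hc : ((finSuccEquiv ℂ m G).map (eval (linePoint p q t))).coeff d = r := by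
    rw [Polynomial.coeff_map, h2, eval_C]
  have hne : (finSuccEquiv ℂ m G).map (eval (linePoint p q t)) ≠ 0 := fun h0 => hr0 <| by
    rw [← hc, h0, Polynomial.coeff_zero]
  have h4 := (Polynomial.coeff_eq_neg_mul_sum_of_card_eq hne hd
    (natDegree_map_finSuccEquiv_le hGd _) (T := T.image fun x => u ⬝ᵥ x)
    (by rw [Finset.card_image_of_injOn hinj, hTc]) (by
      simp only [Finset.forall_mem_image]
      exact fun x hx => hG _ x (hT ▸ Finset.mem_coe.2 hx))).2
  rw [hc, Finset.sum_image hinj, Polynomial.coeff_map, h, ← dotProduct_sum] at h4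
  field_simp
  linear_combination h4

end

theorem proposition1 {k m : ℕ} (hm : 0 < m)
    (I : Ideal (MvPolynomial (Fin k ⊕ Fin m) ℂ)) (hI : I.IsPrime)
    (hdim : ringKrullDim (MvPolynomial (Fin k ⊕ Fin m) ℂ ⧸ I) = m)
    (hV : InGeneralPosition (zeroLocus ℂ I))
    (p q : Fin m → ℂ) (hq : q ≠ 0) :
    ∃ c₀ c₁ : Fin k → ℂ, ∀ t : ℂ, linePoint p q t ∉ ramificationLocus (zeroLocus ℂ I) →
      ∃ S : Finset (Fin k → ℂ),
        (S : Set (Fin k → ℂ)) = {x | (x, t) ∈ sectionCurve (zeroLocus ℂ I) p q} ∧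
        S.card = varietyDegree m (zeroLocus ℂ I) ∧
        ∑ x ∈ S, x = t • c₀ + c₁ := by
  set V := zeroLocus ℂ I with hVdef
  set d := varietyDegree m V with hd
  have hex : ∀ t : ℂ, ∃ T : Finset (Fin k → ℂ), linePoint p q t ∉ ramificationLocus V →
      (T : Set _) = fiber V (linePoint p q t) ∧ T.card = d := fun t => by
    by_cases ht : linePoint p q t ∉ ramificationLocus V
    · have hcard : (fiber V (linePoint p q t)).encard = d := not_not.1 ht
      obtain ⟨T, hT⟩ := (Set.finite_of_encard_eq_coe hcard).exists_finset_coe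
      rw [← hT, Set.encard_coe_eq_coe_finsetCard, Nat.cast_inj] at hcard
      exact ⟨T, fun _ => ⟨hT, hcard⟩⟩
    · exact ⟨∅, fun h => (ht h).elim⟩
  choose T hT using hex
  suffices h : ∃ c₀ c₁ : Fin k → ℂ, ∀ t ∈ {t | linePoint p q t ∉ ramificationLocus V},
      ∑ x ∈ T t, x = t • c₀ + c₁ by
    obtain ⟨c₀, c₁, h⟩ := h
    exact ⟨c₀, c₁, fun t ht => ⟨T t, (hT t ht).1, (hT t ht).2, h t ht⟩⟩
  -- `sInf ∅ = 0`, so only `d > 0` guarantees that `d` counts general sections; for `d = 0` the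
  -- relevant fibers are empty.
  rcases Nat.eq_zero_or_pos d with hd0 | hdpos
  · refine ⟨0, 0, fun t ht => ?_⟩
    rw [Finset.card_eq_zero.1 ((hT t ht).2.trans hd0), Finset.sum_empty, smul_zero, add_zero]
  have hsec : ForGeneral fun a : (Fin m × (Fin k ⊕ Fin m)) ⊕ Fin m → ℂ =>
      (linearSection V a).encard = d := Nat.sInf_mem (Nat.nonempty_of_pos_sInf hdpos)
  have hgen : ForGeneral fun y => (fiber V y).encard = d := by
    obtain ⟨P, hP0, hP⟩ := hV
    exact ⟨P, hP0, fun y hy => not_not.1 (hP y hy)⟩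
  choose G hG0 hGd hG using fun s => exists_relation_momentVector hdim.le hdpos hsec
    (momentVector k s)
  have hfin := finite_setOf_coeff_eq_zero hdpos hgen hG0 hGd hG
  choose R hR0 _ hR using fun t => exists_polynomial_injOn (T t)
  refine exists_affine_of_three_points fun a ha b hb c hc => ?_
  by_contra hE
  refine hfin.infinite_compl ?_
  -- If `s` separates all three fibers and `G s` has degree `d` in `T`, the same `α, β` serve `a, b,
  -- c`, so `momentVector k s` kills the three-point vector.
  refine (R a * R b * R c * momentPolynomial ((b - c) • ∑ x ∈ T a, x + (c - a) • ∑ x ∈ T b, x +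
    (a - b) • ∑ x ∈ T c, x)).roots.toFinset.finite_toSet.subset fun s hs => ?_
  refine Multiset.mem_toFinset.2 ((Polynomial.mem_roots (mul_ne_zero (mul_ne_zero (mul_ne_zero
    (hR0 a) (hR0 b)) (hR0 c)) (momentPolynomial_ne_zero hE))).2 ?_)
  by_contra hroot
  simp only [Polynomial.IsRoot, Polynomial.eval_mul, mul_eq_zero, not_or] at hroot
  obtain ⟨⟨⟨hRa, hRb⟩, hRc⟩, hne⟩ := hroot
  obtain ⟨α, β, h⟩ := exists_affine_sum hdpos (hGd s) hs (hG s) p q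
  rw [eval_momentPolynomial] at hne
  refine hne ?_
  simp only [dotProduct_add, dotProduct_smul, smul_eq_mul,
    h a (T a) (hT a ha).1 (hT a ha).2 (hR a s hRa), h b (T b) (hT b hb).1 (hT b hb).2 (hR b s hRb),
    h c (T c) (hT c hc).1 (hT c hc).2 (hR c s hRc)]
  ring
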